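/- Let $(\Omega,\mathcal F,\mathbb P)$ be a complete probability space, let $X$ be a Polish space with Borel $\sigma$-algebra $\mathcal B(X)$, and let $f:\Omega\times X\to\mathbb R$ be a measurable random function, that is, a function measurable with respect to the product $\sigma$-algebra $\mathcal F\otimes\mathcal B(X)$. Then the mapping $\eta:\Omega\to[-\infty,+\infty]$ defined by $$\eta(\omega)=\inf_{x\in X} f(\omega,x)\qquad\text{for all }\omega\in\Omega$$ is measurable with respect to $\mathcal F$ and the Borel $\sigma$-algebra of $[-\infty,+\infty]$. In particular, whenever this infimum is a real number for every $\omega\in\Omega$, the mapping $\eta:\Omega\to\mathbb R$ is a real-valued random variable. -/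

import Mathlib

open MeasureTheory Set Filter Topology

/-! `{η < a}` is the projection of `{f < a}`, so measurable projection suffices. A
product-measurable set involves only countably many measurable subsets of `Ω`; these define a map
`g` to Cantor space, and the projection is the `g`-preimage of an analytic set. Choquet
capacitability makes that set null measurable for the law of `g`, and completeness of `P` removes
the null set. -/

/-- A set squeezed from inside by measurable sets whose measures approach its outer measure is
null measurable. -/
theorem nullMeasurableSet_of_forall_lt_measure {Y : Type*} [MeasurableSpace Y]
    (μ : Measure Y) [IsFiniteMeasure μ] {s : Set Y}
    (h : ∀ c < μ s, ∃ K ⊆ s, MeasurableSet K ∧ c ≤ μ K) : NullMeasurableSet s μ := by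
  rcases eq_or_ne (μ s) 0 with h0 | h0
  · exact NullMeasurableSet.of_null h0
  obtain ⟨u, -, hu, hlim⟩ := exists_seq_strictMono_tendsto' (pos_iff_ne_zero.2 h0)
  choose K hKs hKm hK using fun n => h (u n) (hu n).2
  have hsub : (⋃ n, K n) ⊆ s := iUnion_subset hKs
  have hle : μ s ≤ μ (⋃ n, K n) :=
    le_of_tendsto' hlim fun n => (hK n).trans (measure_mono (subset_iUnion K n))
  have hae : (⋃ n, K n : Set Y) =ᵐ[μ] toMeasurable μ s :=
    ae_eq_of_subset_of_measure_ge (hsub.trans (subset_toMeasurable μ s))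
      (by rwa [measure_toMeasurable]) (MeasurableSet.iUnion hKm).nullMeasurableSet
      (measure_ne_top _ _)
  refine (MeasurableSet.iUnion hKm).nullMeasurableSet.congr ?_
  exact hsub.eventuallyLE.antisymm
    ((subset_toMeasurable μ s).eventuallyLE.trans hae.symm.le)

/-- An open set of sequences containing the compact box `{x | ∀ i, x i ≤ k i}` contains one of the
cylinders `{x | ∀ i < n, x i ≤ k i}`. -/
theorem exists_cylinder_subset_of_isOpen {V : Set (ℕ → ℕ)} (hV : IsOpen V) (k : ℕ → ℕ)
    (hk : {x : ℕ → ℕ | ∀ i, x i ≤ k i} ⊆ V) :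
    ∃ n, {x : ℕ → ℕ | ∀ i < n, x i ≤ k i} ⊆ V := by
  by_contra! hcon
  choose x hx hxV using fun n => not_subset.1 (hcon n)
  have hcpt : IsCompact (Set.pi univ fun i => Iic (k i)) :=
    isCompact_univ_pi fun i => (finite_Iic (k i)).isCompact
  -- Truncation moves `x n` into the compact box and keeps its coordinates below `n`, so limits
  -- agree.
  obtain ⟨y, hy, σ, hσ, hlim⟩ := hcpt.tendsto_subseq (x := fun n i => min (x n i) (k i))
    (fun n i _ => mem_Iic.2 (min_le_right _ _))
  have hlim' : Tendsto (x ∘ σ) atTop (𝓝 y) := by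
    rw [tendsto_pi_nhds] at hlim ⊢
    intro i
    refine (hlim i).congr' ?_
    filter_upwards [hσ.tendsto_atTop.eventually_gt_atTop i] with n hn
    exact min_eq_left (hx (σ n) i hn)
  obtain ⟨n, hn⟩ := (hlim'.eventually (hV.mem_nhds (hk fun i => hy i (mem_univ i)))).exists
  exact hxV _ hn

/-- The outer measure of an analytic set is approached from inside by compact sets. -/
theorem AnalyticSet.exists_isCompact_measure_le {Y : Type*} [TopologicalSpace Y]
    [MeasurableSpace Y] (μ : Measure Y) [μ.OuterRegular] {s : Set Y} (hs : AnalyticSet s)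
    {c : ENNReal} (hc : c < μ s) : ∃ K ⊆ s, IsCompact K ∧ c ≤ μ K := by
  rw [AnalyticSet] at hs
  rcases hs with rfl | ⟨φ, hφ, rfl⟩
  · simp at hc
  have step : ∀ (n : ℕ) (C : {C : Set (ℕ → ℕ) // c < μ (φ '' C)}),
      ∃ k : ℕ, c < μ (φ '' (C.1 ∩ {x | x n ≤ k})) := by
    rintro n ⟨C, hC⟩
    have hmono : Monotone fun k : ℕ => φ '' (C ∩ {x | x n ≤ k}) := fun a b hab =>
      image_mono (inter_subset_inter_right _ fun x (hx : x n ≤ a) => hx.trans hab)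
    have hU : (⋃ k : ℕ, φ '' (C ∩ {x | x n ≤ k})) = φ '' C := by
      rw [← image_iUnion, ← inter_iUnion]
      congr 1
      exact inter_eq_left.2 fun x _ => mem_iUnion.2 ⟨x n, le_refl (x n)⟩
    -- Continuity from below holds for the outer measure of arbitrary increasing sets.
    rw [← hU, hmono.measure_iUnion] at hC
    exact lt_iSup_iff.1 hC
  choose k hk using step
  let C : ℕ → {C : Set (ℕ → ℕ) // c < μ (φ '' C)} := fun n =>
    Nat.rec ⟨univ, by rwa [image_univ]⟩ (fun n C => ⟨C.1 ∩ {x | x n ≤ k n C}, hk n C⟩) n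
  have hC : ∀ n, (C n).1 = {x | ∀ i < n, x i ≤ k i (C i)} := by
    intro n
    induction n with
    | zero => ext x; simp [C]
    | succ n ih =>
      have : (C (n + 1)).1 = (C n).1 ∩ {x | x n ≤ k n (C n)} := rfl
      rw [this, ih]
      ext x
      simp only [mem_inter_iff, mem_ofPred_eq, Nat.forall_lt_succ_right]
  have hbox : {x : ℕ → ℕ | ∀ i, x i ≤ k i (C i)} = Set.pi univ fun i => Iic (k i (C i)) := by
    ext x; simp [Pi.le_def]
  refine ⟨φ '' {x | ∀ i, x i ≤ k i (C i)}, image_subset_range _ _, ?_, ?_⟩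
  · rw [hbox]
    exact (isCompact_univ_pi fun i => (finite_Iic _).isCompact).image hφ
  -- Outer regularity: the preimage of any open `U ⊇ K` contains some `C n`, whose image has measure
  -- above `c`.
  · rw [Set.measure_eq_iInf_isOpen]
    refine le_iInf₂ fun U hKU => le_iInf fun hU => ?_
    obtain ⟨n, hn⟩ := exists_cylinder_subset_of_isOpen (hU.preimage hφ) _
      (image_subset_iff.1 hKU)
    rw [← hC] at hn
    exact (C n).2.le.trans (measure_mono (image_subset_iff.2 hn))

/-- Analytic sets are universally measurable. -/
theorem AnalyticSet.nullMeasurableSet {Y : Type*} [TopologicalSpace Y] [T2Space Y]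
    [MeasurableSpace Y] [OpensMeasurableSpace Y] (μ : Measure Y) [IsFiniteMeasure μ]
    [μ.OuterRegular] {s : Set Y} (hs : AnalyticSet s) : NullMeasurableSet s μ :=
  nullMeasurableSet_of_forall_lt_measure μ fun _ hc =>
    let ⟨K, hKs, hK, hcK⟩ := AnalyticSet.exists_isCompact_measure_le μ hs hc
    ⟨K, hKs, hK.measurableSet, hcK⟩

/-- A measurable set in a product is a pullback of a measurable set along a measurable map from the
first factor to the Cantor space. -/
theorem exists_preimage_cantor_of_measurableSet_prod {Ω X : Type*} [MeasurableSpace Ω]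
    [MeasurableSpace X] {E : Set (Ω × X)} (hE : MeasurableSet E) :
    ∃ g : Ω → ℕ → Bool, Measurable g ∧ ∃ E' : Set ((ℕ → Bool) × X), MeasurableSet E' ∧
      E = Prod.map g id ⁻¹' E' := by
  classical
  induction E, hE using MeasurableSpace.induction_on_inter generateFrom_prod.symm isPiSystem_prod with
  | empty => exact ⟨fun _ _ => false, measurable_const, ∅, .empty, rfl⟩
  | basic t ht =>
    obtain ⟨A, hA, B, hB, rfl⟩ := ht
    refine ⟨fun ω _ => decide (ω ∈ A), measurable_pi_lambda _ fun _ => ?_,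
      {z | z 0 = true} ×ˢ B, (measurableSet_eq_fun (measurable_pi_apply 0)
        measurable_const).prod hB, ?_⟩
    · exact measurable_to_bool (by simpa [preimage] using hA)
    · ext ⟨ω, x⟩; simp
  | compl t _ ih =>
    obtain ⟨g, hg, E', hE', rfl⟩ := ih
    exact ⟨g, hg, E'ᶜ, hE'.compl, rfl⟩
  | iUnion t _ _ ih =>
    choose g hg E' hE' h using ih
    -- Pairing merges the countably many codes into one sequence.
    refine ⟨fun ω n => g n.unpair.1 ω n.unpair.2, measurable_pi_lambda _ fun n =>
      (measurable_pi_apply _).comp (hg _),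
      ⋃ n, Prod.map (fun z m => z (Nat.pair n m)) id ⁻¹' E' n, .iUnion fun n => ?_, ?_⟩
    · exact (Measurable.prodMap (measurable_pi_lambda _ fun m => measurable_pi_apply _)
        measurable_id) (hE' n)
    · ext ⟨ω, x⟩
      simp only [h, mem_iUnion, mem_preimage, Prod.map_apply, id, Nat.unpair_pair]

/-- Measurable projection theorem. -/
theorem measurableSet_image_fst_of_isComplete {Ω X : Type*} [MeasurableSpace Ω]
    (P : Measure Ω) [IsFiniteMeasure P] [P.IsComplete]
    [TopologicalSpace X] [PolishSpace X] [MeasurableSpace X] [BorelSpace X]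
    {E : Set (Ω × X)} (hE : MeasurableSet E) : MeasurableSet (Prod.fst '' E) := by
  obtain ⟨g, hg, E', hE', rfl⟩ := exists_preimage_cantor_of_measurableSet_prod hE
  have himg : Prod.fst '' (Prod.map g id ⁻¹' E') = g ⁻¹' (Prod.fst '' E') := by
    ext ω; simp
  have : PolishSpace (ℕ → Bool) := {}
  have han : AnalyticSet (Prod.fst '' E') := hE'.analyticSet.image_of_continuous continuous_fst
  rw [himg]
  exact ((AnalyticSet.nullMeasurableSet (P.map g) han).preimage
    (hg.quasiMeasurePreserving P)).measurable_of_complete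

theorem mainTheorem7 {Ω X : Type*} [MeasurableSpace Ω]
    (P : MeasureTheory.Measure Ω) [MeasureTheory.IsProbabilityMeasure P] [P.IsComplete]
    [TopologicalSpace X] [PolishSpace X] [MeasurableSpace X] [BorelSpace X]
    (f : Ω × X → ℝ) (hf : Measurable f) :
    Measurable (fun ω : Ω => ⨅ x : X, (f (ω, x) : EReal)) ∧
      ∀ η : Ω → ℝ, (∀ ω, IsGLB (Set.range fun x : X => f (ω, x)) (η ω)) → Measurable η := by
  refine ⟨measurable_of_Iio fun a => ?_, fun η hη => measurable_of_Iio fun a => ?_⟩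
  · have hset : (fun ω : Ω => ⨅ x : X, (f (ω, x) : EReal)) ⁻¹' Iio a =
        Prod.fst '' {p : Ω × X | (f p : EReal) < a} := by
      ext ω; simp [iInf_lt_iff]
    rw [hset]
    exact measurableSet_image_fst_of_isComplete P
      (measurableSet_lt hf.coe_real_ereal measurable_const)
  · have hset : η ⁻¹' Iio a = Prod.fst '' {p : Ω × X | f p < a} := by
      ext ω; simp [isGLB_lt_iff (hη ω)]
    rw [hset]
    exact measurableSet_image_fst_of_isComplete P (measurableSet_lt hf measurable_const)
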